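/- Let $\lambda$ be Lebesgue measure on $[0,1]$ and $\mathcal M$ the $\sigma$-algebra of all Lebesgue measurable subsets of $[0,1]$. For a measurable function $f\colon[0,1]\to\mathbb R$ let $f^*(t)=\inf\{\tau\ge 0:\lambda(\{|f|>\tau\})\le t\}$ be its decreasing rearrangement. A rearrangement invariant (r.i.) space on $[0,1]$ is a non-zero Banach space $X$ of classes of $\lambda$-a.e. equal real measurable functions on $[0,1]$ such that - if $f\in X$ and $|g|\le|f|$ a.e., then $g\in X$ and $\|g\|_X\le\|f\|_X$; - if $f\in X$ and $g^*\le f^*$, then $g\in X$ and $\|g\|_X\le\|f\|_X$. Let $\mathcal C(f)(x)=\frac1x\int_0^x f(t)\,dt$ be the Cesàro operator. **Theorem.** Let $X$ be an r.i. space on $[0,1]$ with $X\neq L^\infty$ (as sets). For $A\in\mathcal M$ and $0<y\le 1$ the functions $m_X(A):=\mathcal C(\chi_A)$ and $F_y(x):=\frac1x\chi_{[y,1]}(x)$ belong to $X$, and the following hold (the value of $F$ at the single point $y=0$ is immaterial). (a) The set function $m_X\colon\mathcal M\to X$ is $\sigma$-additive, i.e. it is a vector measure. (b) The function $F\colon y\mapsto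 F_y$ is strongly measurable and Pettis $\lambda$-integrable, and it is a density of $m_X$: for all $A\in\mathcal M$ and $x^*\in X^*$, the function $y\mapsto\langle F_y,x^*\rangle$ is integrable and $\langle m_X(A),x^*\rangle=\int_A\langle F_y,x^*\rangle\,dy$. (c) The variation $|m_X|$ is $\sigma$-finite, and $|m_X|(A)=\int_A\|F_y\|_X\,dy$ for all $A\in\mathcal M$. If $|m_X|([0,1])<\infty$, then $F$ is Bochner $\lambda$-integrable. (d) The range $m_X(\mathcal M)=\{m_X(A):A\in\mathcal M\}$ is relatively compact in $X$. -/

import Mathlib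

open MeasureTheory Set
open scoped ENNReal unitInterval

/-- A normed space of (classes of a.e. equal) real measurable functions on `[0,1]`: a linear
subspace of `L⁰[0,1]` together with a norm on it. -/
structure NormedFunctionSpace where
  carrier : Submodule ℝ (I →ₘ[(volume : Measure I)] ℝ)
  toNorm : Norm carrier
  core : NormedSpace.Core ℝ carrier

namespace NormedFunctionSpace

/-- The normed space `X`, as a type. -/
def Elem (X : NormedFunctionSpace) : Type := X.carrier

instance : CoeSort NormedFunctionSpace Type := ⟨Elem⟩

noncomputable instance (X : NormedFunctionSpace) : NormedAddCommGroup X :=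
  letI : NormedAddCommGroup X.carrier := letI := X.toNorm; NormedAddCommGroup.ofCore X.core
  inferInstanceAs (NormedAddCommGroup X.carrier)

noncomputable instance (X : NormedFunctionSpace) : NormedSpace ℝ X :=
  letI : NormedAddCommGroup X.carrier := letI := X.toNorm; NormedAddCommGroup.ofCore X.core
  letI : NormedSpace ℝ X.carrier := letI := X.toNorm; NormedSpace.ofCore X.core
  inferInstanceAs (NormedSpace ℝ X.carrier)

/-- The class of functions underlying an element of `X`. -/
noncomputable def toFun {X : NormedFunctionSpace} : X →ₗ[ℝ] (I →ₘ[(volume : Measure I)] ℝ) where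
  toFun f := Subtype.val f
  map_add' _ _ := rfl
  map_smul' _ _ := rfl

theorem toFun_injective {X : NormedFunctionSpace} : Function.Injective (toFun (X := X)) :=
  Subtype.val_injective

theorem range_toFun (X : NormedFunctionSpace) : LinearMap.range (toFun (X := X)) = X.carrier :=
  SetLike.coe_injective Subtype.range_val

/-- A Banach function space on `[0,1]`: complete, and if `f ∈ X` and `|g| ≤ |f|` a.e., then
`g ∈ X` and `‖g‖ ≤ ‖f‖`. -/
structure IsBanachFunctionSpace (X : NormedFunctionSpace) : Prop where
  complete : CompleteSpace X
  ideal : ∀ (f : X) (g : I →ₘ[(volume : Measure I)] ℝ), (∀ᵐ x, |g x| ≤ |toFun f x|) →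
    ∃ h : X, toFun h = g ∧ ‖h‖ ≤ ‖f‖

end NormedFunctionSpace

/-- The distribution function `τ ↦ λ {t ∈ [0,1] : |f t| > τ}`. -/
noncomputable def distributionFunction (f : I → ℝ) (τ : ℝ≥0∞) : ℝ≥0∞ :=
  volume {t : I | τ < ‖f t‖ₑ}

/-- The decreasing rearrangement `f* t = inf {τ ≥ 0 : λ_f τ ≤ t}`, the right-continuous inverse of
the distribution function. Its only possibly infinite value is `f* 0`, the essential supremum
of `|f|`. -/
noncomputable def decreasingRearrangement (f : I → ℝ) (t : I) : ℝ≥0∞ :=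
  sInf {τ : ℝ≥0∞ | distributionFunction f τ ≤ ENNReal.ofReal t}

/-- A rearrangement invariant space on `[0,1]`: a Banach function space such that `f ∈ X` and
`g* ≤ f*` imply `g ∈ X` and `‖g‖ ≤ ‖f‖`. -/
structure NormedFunctionSpace.IsRearrangementInvariant (X : NormedFunctionSpace) : Prop
    extends X.IsBanachFunctionSpace where
  rearrangement : ∀ (f : X) (g : I →ₘ[(volume : Measure I)] ℝ),
    (∀ t : I, decreasingRearrangement g t ≤ decreasingRearrangement (toFun f) t) →
    ∃ h : X, toFun h = g ∧ ‖h‖ ≤ ‖f‖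

/-- `[0,1]` with the σ-algebra of all Lebesgue measurable sets. -/
abbrev LebesgueInterval : Type := NullMeasurableSpace I (volume : Measure I)

/-- Lebesgue measure on all Lebesgue measurable subsets of `[0,1]`. -/
noncomputable abbrev lebesgueInterval : Measure LebesgueInterval :=
  (volume : Measure I).completion

/-- The Cesàro operator `(C f)(x) = (1/x) ∫₀ˣ f(t) dt`. -/
noncomputable def cesaro (f : I → ℝ) (x : I) : ℝ :=
  1 / (x : ℝ) * ∫ t in Iic x, f t

/-- The function `F_y(x) = (1/x) χ_{[y,1]}(x)`. -/
noncomputable def cesaroKernel (y x : I) : ℝ :=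
  1 / (x : ℝ) * (Icc y 1).indicator 1 x

section Pettis

variable {Ω E : Type*} [MeasurableSpace Ω] [NormedAddCommGroup E] [NormedSpace ℝ E]

/-- `v` is the Pettis integral of `F` over `A`. -/
def IsPettisIntegralOn (μ : Measure Ω) (F : Ω → E) (A : Set Ω) (v : E) : Prop :=
  ∀ φ : StrongDual ℝ E, IntegrableOn (fun ω => φ (F ω)) A μ ∧ φ v = ∫ ω in A, φ (F ω) ∂μ

/-- `F` is Pettis integrable: it is scalarly integrable and has a Pettis integral over every
measurable set. -/
def PettisIntegrable (μ : Measure Ω) (F : Ω → E) : Prop :=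
  ∀ A : Set Ω, MeasurableSet A → ∃ v : E, IsPettisIntegralOn μ F A v

end Pettis

/-!
Let `e` be the constant function `1` and `χ_B` the indicator of `B`. A nonzero r.i. space contains
the indicators of small intervals, hence `e`, hence all bounded functions. If `X ≠ L^∞`, then `X`
contains an unbounded `w`, and comparing `χ_B` with the indicators of `{|w| > n}` shows that
`‖χ_B‖ → 0` as `λ(B) → 0` (`NormedFunctionSpace.exists_norm_indicator_le`). All parts of the theorem
rest on this and on pointwise estimates.

* Since `C(χ_A) ≤ χ_{[0,r]} + (λ(A) / r) e`, also `‖C(χ_A)‖ → 0` as `λ(A) → 0`, so that the finitely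
  additive set function `m : A ↦ C(χ_A)` is σ-additive
  (`NormedFunctionSpace.exists_vectorMeasure_represents_cesaro`).
* If `y, w ≥ ε` and `|y - w| ≤ δ`, then `|F_y - F_w| ≤ χ_{B(w,δ)} / ε`. Hence `F` is continuous and
  bounded on `[ε,1]`. If `w ∈ A ⊆ [ε,1] ∩ B(w,δ)`, then
  `|C(χ_A) - λ(A) F_w| ≤ (λ(A) / ε) χ_{B(w,δ)}`. Adding up over small pieces, `m A` is the Bochner
  integral of `F` over `A`, for all measurable `A ⊆ [ε,1]`
  (`NormedFunctionSpace.hasBochnerDensityOn_of_represents_cesaro`).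
* Dividing `[0,1]` into `{0}` and the intervals `(1/(n+1), 1/n]`, and using that the variation of
  `m` is a measure, one gets `|m|(A) = ∫_A ‖F_y‖ dy` for all `A`. The same identity for the scalar
  measure `φ ∘ m`, which has finite variation, gives the integrability of `φ ∘ F`, and so the Pettis
  integral (`MeasureTheory.VectorMeasure.HasBochnerDensityOn.isPettisIntegralOn`).
* The values of `m` on subsets of `[r,1]` lie in the closed absolutely convex hull of the compact
  set `F([r,1])`, which is compact, and its values on subsets of `[0,r]` are uniformly small
  (`NormedFunctionSpace.totallyBounded_range_of_represents_cesaro`).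
-/

/-! ### Vector measures with a locally Bochner integrable density -/

namespace MeasureTheory.VectorMeasure

variable {Ω E : Type*} [MeasurableSpace Ω] [NormedAddCommGroup E]

theorem variation_le_of_forall_fiber {d : VectorMeasure Ω E} {ν : Measure Ω} {k : Ω → ℕ}
    (hk : Measurable k)
    (h : ∀ n A, MeasurableSet A → A ⊆ k ⁻¹' {n} → ‖d A‖ₑ ≤ ν A) : d.variation ≤ ν := by
  refine Measure.le_intro fun A hA _ => ?_
  have hpre : ∀ n, MeasurableSet (A ∩ k ⁻¹' {n}) :=
    fun n => hA.inter (hk (measurableSet_singleton n))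
  have hdisj : Pairwise (Function.onFun Disjoint fun n => A ∩ k ⁻¹' {n}) := by
    intro i j hij
    exact (Disjoint.preimage k (by simpa using hij)).mono inter_subset_right inter_subset_right
  have hU : A = ⋃ n, A ∩ k ⁻¹' {n} := by ext x; simp
  rw [hU, measure_iUnion hdisj hpre, measure_iUnion hdisj hpre]
  exact ENNReal.tsum_le_tsum fun n => variation_apply_le_of_forall_enorm_le (hpre n)
    fun B hB hBA => h n B hB (hBA.trans inter_subset_right)

theorem eq_zero_of_forall_fiber {d : VectorMeasure Ω E} {k : Ω → ℕ} (hk : Measurable k)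
    (h : ∀ n A, MeasurableSet A → A ⊆ k ⁻¹' {n} → d A = 0) : d = 0 := by
  rw [← variation_eq_zero]
  refine le_antisymm ?_ (Measure.zero_le _)
  exact variation_le_of_forall_fiber hk fun n A hA hAk => by simp [h n A hA hAk]

variable [NormedSpace ℝ E]

/-- `F` is a density of `m` with respect to `μ` on every measurable subset of `S`, in the sense of
the Bochner integral. -/
structure HasBochnerDensityOn (m : VectorMeasure Ω E) (F : Ω → E) (μ : Measure Ω) (S : Set Ω) :
    Prop where
  integrableOn : IntegrableOn F S μ
  apply_eq : ∀ A, MeasurableSet A → A ⊆ S → m A = ∫ x in A, F x ∂μ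

namespace HasBochnerDensityOn

variable {m : VectorMeasure Ω E} {F : Ω → E} {μ : Measure Ω} {S : Set Ω} {k : Ω → ℕ}

theorem of_measure_zero (hS : μ S = 0) (h : ∀ A, MeasurableSet A → A ⊆ S → m A = 0) :
    HasBochnerDensityOn m F μ S where
  integrableOn := by
    rw [IntegrableOn, Measure.restrict_eq_zero.2 hS]
    exact integrable_zero_measure
  apply_eq A hA hAS := by
    rw [h A hA hAS, setIntegral_measure_zero _ (measure_mono_null hAS hS)]

theorem mono {T : Set Ω} (h : HasBochnerDensityOn m F μ S) (hTS : T ⊆ S) :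
    HasBochnerDensityOn m F μ T :=
  ⟨h.integrableOn.mono_set hTS, fun A hA hAT => h.apply_eq A hA (hAT.trans hTS)⟩

/-- If `Ω` can be divided into countably many pieces such that on the subsets `A` of each piece
`m A` is close to `μ(A) v` and `F` is close to `v`, then the variation of the difference of `m` and
the Bochner integral of `F` is an arbitrarily small multiple of `μ`. -/
theorem of_forall_exists_approx [CompleteSpace E] [IsFiniteMeasure μ] (hS : MeasurableSet S)
    (hF : IntegrableOn F S μ)
    (h : ∀ c : ℝ, 0 < c → ∃ k : Ω → ℕ, Measurable k ∧ ∀ j A, MeasurableSet A → A ⊆ S →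
      A ⊆ k ⁻¹' {j} → A.Nonempty →
      ∃ v : E, ‖m A - μ.real A • v‖ ≤ c * μ.real A ∧ ∀ x ∈ A, ‖F x - v‖ ≤ c) :
    HasBochnerDensityOn m F μ S := by
  refine ⟨hF, ?_⟩
  set d : VectorMeasure Ω E := m.restrict S - (μ.restrict S).withDensityᵥ F with hd
  have hdA : ∀ A, MeasurableSet A → d A = m (A ∩ S) - ∫ x in A ∩ S, F x ∂μ := fun A hA => by
    rw [hd, _root_.sub_apply, VectorMeasure.restrict_apply _ hS hA, withDensityᵥ_apply hF hA,
      Measure.restrict_restrict hA]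
  have hsmall : ∀ c : ℝ, 0 < c → d.variation ≤ ENNReal.ofReal (2 * c) • μ := by
    intro c hc
    obtain ⟨k, hk, H⟩ := h c hc
    refine variation_le_of_forall_fiber hk fun j A hA hAj => ?_
    rcases (A ∩ S).eq_empty_or_nonempty with h0 | hne
    · rw [hdA A hA, h0, VectorMeasure.empty, MeasureTheory.setIntegral_empty, sub_zero, enorm_zero]
      exact zero_le
    obtain ⟨v, h1, h2⟩ := H j (A ∩ S) (hA.inter hS) inter_subset_right
      (inter_subset_left.trans hAj) hne
    have h3 : ‖(∫ x in A ∩ S, F x ∂μ) - μ.real (A ∩ S) • v‖ ≤ c * μ.real (A ∩ S) := by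
      rw [← MeasureTheory.setIntegral_const,
        ← MeasureTheory.integral_sub (hF.mono_set inter_subset_right)
        (MeasureTheory.integrableOn_const (measure_ne_top _ _))]
      exact MeasureTheory.norm_setIntegral_le_of_norm_le_const (measure_lt_top _ _) h2
    have hle : ‖d A‖ ≤ 2 * c * μ.real A := by
      rw [hdA A hA]
      calc _ = ‖(m (A ∩ S) - μ.real (A ∩ S) • v) -
            ((∫ x in A ∩ S, F x ∂μ) - μ.real (A ∩ S) • v)‖ := by rw [sub_sub_sub_cancel_right]
        _ ≤ c * μ.real (A ∩ S) + c * μ.real (A ∩ S) :=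
            (norm_sub_le _ _).trans (add_le_add h1 h3)
        _ = 2 * c * μ.real (A ∩ S) := by ring
        _ ≤ 2 * c * μ.real A := by
            gcongr
            exacts [measure_ne_top _ _, inter_subset_left]
    rw [Measure.smul_apply, smul_eq_mul, ← ofReal_norm,
      ← ENNReal.ofReal_toReal (measure_ne_top μ A), ← ENNReal.ofReal_mul (by positivity)]
    exact ENNReal.ofReal_le_ofReal hle
  intro A hA hAS
  have hlim : Filter.Tendsto (fun c : ℝ => ENNReal.ofReal (2 * c) * μ A)
      (nhdsWithin 0 (Ioi 0)) (nhds 0) := by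
    have h1 : Filter.Tendsto (fun c : ℝ => ENNReal.ofReal (2 * c)) (nhdsWithin 0 (Ioi 0))
        (nhds (ENNReal.ofReal (2 * 0))) :=
      (ENNReal.continuous_ofReal.comp (continuous_const.mul continuous_id)).continuousAt.mono_left
        nhdsWithin_le_nhds
    simpa using ENNReal.Tendsto.mul_const h1 (.inr (measure_ne_top μ A))
  have hd0 : ‖d A‖ₑ ≤ 0 := ge_of_tendsto hlim (by
    filter_upwards [self_mem_nhdsWithin] with c hc
    exact (enorm_measure_le_variation d A).trans (hsmall c hc A))
  rw [nonpos_iff_eq_zero, enorm_eq_zero, hdA A hA, inter_eq_self_of_subset_left hAS] at hd0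
  exact sub_eq_zero.1 hd0

theorem apply_mem [CompleteSpace E] [IsProbabilityMeasure μ] (h : HasBochnerDensityOn m F μ S)
    {A : Set Ω} (hA : MeasurableSet A) (hAS : A ⊆ S) {K : Set E} (hK : Convex ℝ K)
    (hKc : IsClosed K) (h0 : (0 : E) ∈ K) (hFK : ∀ x ∈ A, F x ∈ K) : m A ∈ K := by
  rw [h.apply_eq _ hA hAS, ← MeasureTheory.integral_indicator hA]
  refine hK.integral_mem hKc (.of_forall fun x => ?_)
    ((MeasureTheory.integrable_indicator_iff hA).2 (h.integrableOn.mono_set hAS))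
  by_cases hx : x ∈ A
  · rw [indicator_of_mem hx]
    exact hFK x hx
  · rwa [indicator_of_notMem hx]

theorem map {E' : Type*} [NormedAddCommGroup E'] [NormedSpace ℝ E'] [CompleteSpace E]
    [CompleteSpace E'] (h : HasBochnerDensityOn m F μ S) (φ : E →L[ℝ] E') :
    HasBochnerDensityOn (m.mapRange φ.toLinearMap.toAddMonoidHom φ.continuous)
      (fun x => φ (F x)) μ S where
  integrableOn := φ.integrable_comp h.integrableOn
  apply_eq A hA hAS := by
    rw [φ.integral_comp_comm (h.integrableOn.mono_set hAS), ← h.apply_eq A hA hAS]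
    exact mapRange_apply _ φ.continuous

theorem variation_apply [CompleteSpace E] (h : HasBochnerDensityOn m F μ S)
    (hS : MeasurableSet S) {A : Set Ω} (hA : MeasurableSet A) (hAS : A ⊆ S) :
    m.variation A = ∫⁻ x in A, ‖F x‖ₑ ∂μ := by
  have hm : m.restrict S = (μ.restrict S).withDensityᵥ F := by
    ext B hB
    rw [restrict_apply _ hS hB, withDensityᵥ_apply h.integrableOn hB, Measure.restrict_restrict hB]
    exact h.apply_eq _ (hB.inter hS) inter_subset_right
  have := congrArg (fun v => v.variation A) hm
  simp only [variation_restrict hS, Measure.variation_withDensityᵥ h.integrableOn] at this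
  rwa [Measure.restrict_apply hA, MeasureTheory.withDensity_apply _ hA,
    Measure.restrict_restrict hA,
    inter_eq_self_of_subset_left hAS] at this

/-- Both sides are measures, so that it suffices to compare them on the pieces on which `F` is
Bochner integrable. -/
theorem variation_eq_withDensity [CompleteSpace E] (hk : Measurable k)
    (h : ∀ n, HasBochnerDensityOn m F μ (k ⁻¹' {n})) :
    m.variation = μ.withDensity fun x => ‖F x‖ₑ := by
  have hS : ∀ n, MeasurableSet (k ⁻¹' {n}) := fun n => hk (measurableSet_singleton n)
  refine Measure.ext_of_iUnion_eq_univ (s := fun n => k ⁻¹' {n}) (by ext; simp) fun n => ?_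
  ext A hA
  rw [Measure.restrict_apply hA, Measure.restrict_apply hA,
    (h n).variation_apply (hS n) (hA.inter (hS n)) inter_subset_right,
    MeasureTheory.withDensity_apply _ (hA.inter (hS n))]

theorem apply_eq_setIntegral [CompleteSpace E] (hk : Measurable k)
    (h : ∀ n, HasBochnerDensityOn m F μ (k ⁻¹' {n})) (hF : Integrable F μ) {A : Set Ω}
    (hA : MeasurableSet A) : m A = ∫ x in A, F x ∂μ := by
  have : m - μ.withDensityᵥ F = 0 := eq_zero_of_forall_fiber hk fun n B hB hBk => by
    rw [sub_apply, withDensityᵥ_apply hF hB, (h n).apply_eq B hB hBk, sub_self]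
  rw [sub_eq_zero.1 this, withDensityᵥ_apply hF hA]

/-- The scalar measure `φ ∘ m` has finite variation, which makes its local density `φ ∘ F`
integrable even when `F` is not Bochner integrable. -/
theorem isPettisIntegralOn [CompleteSpace E] (hk : Measurable k)
    (h : ∀ n, HasBochnerDensityOn m F μ (k ⁻¹' {n})) (hF : AEStronglyMeasurable F μ) {A : Set Ω}
    (hA : MeasurableSet A) : IsPettisIntegralOn μ F A (m A) := by
  intro φ
  have hφ := fun n => (h n).map φ
  have hint : Integrable (fun x => φ (F x)) μ := by
    refine ⟨φ.continuous.comp_aestronglyMeasurable hF, ?_⟩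
    rw [hasFiniteIntegral_iff_enorm, ← setLIntegral_univ, ← MeasureTheory.withDensity_apply _ .univ,
      ← variation_eq_withDensity hk hφ, ← SignedMeasure.totalVariation_eq_variation]
    exact measure_lt_top _ _
  exact ⟨hint.integrableOn, apply_eq_setIntegral hk hφ hint hA⟩

end HasBochnerDensityOn

end MeasureTheory.VectorMeasure

/-! ### Indicators in rearrangement invariant spaces -/

theorem decreasingRearrangement_mono {f g : I → ℝ}
    (h : ∀ τ, distributionFunction f τ ≤ distributionFunction g τ) (t : I) :
    decreasingRearrangement f t ≤ decreasingRearrangement g t :=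
  sInf_le_sInf fun τ hτ => (h τ).trans hτ

theorem distributionFunction_of_ae_eq_indicator {f : I → ℝ} {B : Set I}
    (hf : f =ᵐ[volume] B.indicator 1) (τ : ℝ≥0∞) :
    distributionFunction f τ = if τ < 1 then volume B else 0 := by
  have : {t : I | τ < ‖f t‖ₑ} =ᵐ[volume] (if τ < 1 then B else ∅ : Set I) := by
    refine Filter.eventuallyEq_set.2 ?_
    filter_upwards [hf] with t ht
    by_cases htB : t ∈ B <;> by_cases hτ : τ < 1 <;> simp [ht, htB, hτ]
  rw [distributionFunction, measure_congr this]
  split_ifs <;> simp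

namespace NormedFunctionSpace

variable {X : NormedFunctionSpace}

/-- The element `v` of `X` is the class of the function `g`. -/
def Represents (v : X) (g : I → ℝ) : Prop := toFun v =ᵐ[volume] g

namespace Represents

variable {v w : X} {f g : I → ℝ}

theorem unique (hv : Represents v g) (hw : Represents w g) : v = w :=
  toFun_injective (AEEqFun.ext (hv.trans hw.symm))

theorem zero : Represents (0 : X) 0 := by
  unfold Represents
  rw [map_zero]
  exact AEEqFun.coeFn_zero

theorem add (hv : Represents v f) (hw : Represents w g) : Represents (v + w) (f + g) := by
  unfold Represents
  rw [map_add]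
  exact (AEEqFun.coeFn_add _ _).trans (Filter.EventuallyEq.add hv hw)

theorem sub (hv : Represents v f) (hw : Represents w g) : Represents (v - w) (f - g) := by
  unfold Represents
  rw [map_sub]
  exact (AEEqFun.coeFn_sub _ _).trans (Filter.EventuallyEq.sub hv hw)

theorem smul (c : ℝ) (hv : Represents v f) : Represents (c • v) (c • f) := by
  unfold Represents
  rw [map_smul]
  exact (AEEqFun.coeFn_smul _ _).trans (Filter.EventuallyEq.const_smul hv c)

theorem sum {ι : Type*} (s : Finset ι) {v : ι → X} {f : ι → I → ℝ}
    (h : ∀ i, Represents (v i) (f i)) : Represents (∑ i ∈ s, v i) (∑ i ∈ s, f i) := by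
  classical
  induction s using Finset.induction_on with
  | empty => simpa using zero
  | insert i s hi ih => simpa only [Finset.sum_insert hi] using (h i).add ih

theorem exists_of_abs_le (hX : X.IsBanachFunctionSpace) (hw : Represents w f)
    (hg : AEStronglyMeasurable g volume) {c : ℝ} (hc : 0 ≤ c)
    (h : ∀ᵐ x : I, |g x| ≤ c * |f x|) : ∃ v : X, Represents v g ∧ ‖v‖ ≤ c * ‖w‖ := by
  obtain ⟨v, hv, hle⟩ := hX.ideal (c • w) (AEEqFun.mk g hg) (by
    filter_upwards [h, hw.smul c, AEEqFun.coeFn_mk g hg] with x hx hcw hmk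
    rw [hmk, hcw]
    simpa [abs_mul, abs_of_nonneg hc] using hx)
  refine ⟨v, ?_, hle.trans_eq (by rw [norm_smul, Real.norm_of_nonneg hc])⟩
  unfold Represents
  rw [hv]
  exact AEEqFun.coeFn_mk g hg

theorem norm_le (hX : X.IsBanachFunctionSpace) (hv : Represents v g) (hw : Represents w f)
    {c : ℝ} (hc : 0 ≤ c) (h : ∀ x, |g x| ≤ c * |f x|) : ‖v‖ ≤ c * ‖w‖ := by
  obtain ⟨u, hu, hle⟩ := hw.exists_of_abs_le hX
    ((AEEqFun.aestronglyMeasurable _).congr hv) hc (.of_forall h)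
  rwa [hv.unique hu]

/-- Rearrangement invariance for indicators: the norm of `χ_B` is monotone in `λ(B)`. -/
theorem exists_indicator (hX : X.IsRearrangementInvariant) {D : Set I}
    (hw : Represents w (D.indicator 1)) {B : Set I} (hB : NullMeasurableSet B)
    (hBD : volume B ≤ volume D) : ∃ v : X, Represents v (B.indicator 1) ∧ ‖v‖ ≤ ‖w‖ := by
  have hm : AEStronglyMeasurable (B.indicator (1 : I → ℝ)) volume :=
    aestronglyMeasurable_one.indicator₀ hB
  obtain ⟨v, hv, hle⟩ := hX.rearrangement w (AEEqFun.mk _ hm) (decreasingRearrangement_mono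
    fun τ => by
      rw [distributionFunction_of_ae_eq_indicator (AEEqFun.coeFn_mk _ hm),
        distributionFunction_of_ae_eq_indicator hw]
      split_ifs <;> simp [hBD])
  refine ⟨v, ?_, hle⟩
  unfold Represents
  rw [hv]
  exact AEEqFun.coeFn_mk _ hm

end Represents

/-- A Chebyshev estimate: the indicator of a level set of `w` lies in `X`. -/
theorem exists_represents_indicator_lt_abs (hX : X.IsBanachFunctionSpace) (w : X) {c : ℝ}
    (hc : 0 < c) : ∃ v : X, Represents v ({x : I | c < |toFun w x|}.indicator 1) ∧
      ‖v‖ ≤ c⁻¹ * ‖w‖ := by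
  have hm : NullMeasurableSet {x : I | c < |toFun w x|} (volume : Measure I) :=
    (aestronglyMeasurable_const.nullMeasurableSet_lt
      (continuous_abs.comp_aestronglyMeasurable (toFun w).aestronglyMeasurable))
  refine Represents.exists_of_abs_le (w := w) (f := toFun w) hX .rfl
    (aestronglyMeasurable_one.indicator₀ hm) (inv_nonneg.2 hc.le) (.of_forall fun x => ?_)
  by_cases hx : c < |toFun w x|
  · rw [indicator_of_mem (by exact hx), inv_mul_eq_div, le_div_iff₀ hc]
    simpa using hx.le
  · rw [indicator_of_notMem (by exact hx)]
    simp only [abs_zero]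
    positivity

/-- A nonzero r.i. space contains the constants: it contains the indicator of some set of positive
measure, hence of all intervals of length at most `1 / N` for a large `N`, and these cover `[0,1]`. -/
theorem exists_represents_one (hX : X.IsRearrangementInvariant) (hne : X.carrier ≠ ⊥) :
    ∃ e : X, Represents e 1 := by
  obtain ⟨f, hf, hf0⟩ := X.carrier.ne_bot_iff.1 hne
  let w : X := ⟨f, hf⟩
  have hw : toFun w = f := rfl
  obtain ⟨c, hc, hD⟩ : ∃ c : ℝ, 0 < c ∧ volume {x : I | c < |toFun w x|} ≠ 0 := by
    by_contra! h
    refine hf0 (AEEqFun.ext (Filter.EventuallyEq.trans ?_ AEEqFun.coeFn_zero.symm))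
    have : ∀ n : ℕ, ∀ᵐ x : I, |f x| ≤ 1 / ((n : ℝ) + 1) := fun n => by
      have := h (1 / ((n : ℝ) + 1)) (by positivity)
      rw [hw] at this
      simpa [ae_iff] using this
    filter_upwards [ae_all_iff.2 this] with x hx
    exact abs_nonpos_iff.1 (ge_of_tendsto' tendsto_one_div_add_atTop_nhds_zero_nat hx)
  obtain ⟨v, hv, -⟩ := exists_represents_indicator_lt_abs hX.toIsBanachFunctionSpace w hc
  obtain ⟨N, hN⟩ := ENNReal.exists_inv_nat_lt hD
  have hN0 : 0 < N := Nat.pos_of_ne_zero (by rintro rfl; simp at hN)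
  have hNR : (0 : ℝ) < N := Nat.cast_pos.2 hN0
  let J : ℕ → Set I := fun j => {x : I | ⌊(x : ℝ) * N⌋₊ = j}
  have hJm : ∀ j, MeasurableSet (J j) := fun j =>
    (Nat.measurable_floor.comp (by fun_prop : Measurable fun x : I => (x : ℝ) * N))
      (measurableSet_singleton j)
  have hJv : ∀ j, volume (J j) ≤ (N : ℝ≥0∞)⁻¹ := fun j => by
    have hsub : Subtype.val '' J j ⊆ Icc ((j : ℝ) / N) ((j + 1) / N) := by
      rintro _ ⟨x, hx, rfl⟩
      have hx : ⌊(x : ℝ) * N⌋₊ = j := hx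
      rw [Nat.floor_eq_iff (mul_nonneg x.2.1 hNR.le)] at hx
      exact ⟨(div_le_iff₀ hNR).2 hx.1, (le_div_iff₀ hNR).2 hx.2.le⟩
    rw [unitInterval.volume_apply]
    refine (measure_mono hsub).trans ?_
    rw [Real.volume_Icc, ← sub_div, add_sub_cancel_left, ENNReal.ofReal_div_of_pos hNR]
    simp
  choose u hu _ using fun j => hv.exists_indicator hX (hJm j).nullMeasurableSet
    ((hJv j).trans hN.le)
  refine ⟨∑ j ∈ Finset.range (N + 1), u j, ?_⟩
  convert! Represents.sum (Finset.range (N + 1)) hu using 1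
  ext x
  have hx : ⌊(x : ℝ) * N⌋₊ < N + 1 := Nat.lt_succ_of_le <| Nat.floor_le_of_le <|
    mul_le_of_le_one_left hNR.le x.2.2
  simp [J, indicator_apply, hx]

theorem exists_represents_of_bounded (hX : X.IsBanachFunctionSpace) {e : X}
    (he : Represents e 1) {g : I → ℝ} (hg : AEStronglyMeasurable g volume) {c : ℝ}
    (h : ∀ᵐ x : I, |g x| ≤ c) : ∃ v : X, Represents v g := by
  have hc : ∀ᵐ x : I, |g x| ≤ |c| * |(1 : I → ℝ) x| := by
    filter_upwards [h] with x hx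
    simpa using hx.trans (le_abs_self c)
  obtain ⟨v, hv, -⟩ := he.exists_of_abs_le hX hg (abs_nonneg c) hc
  exact ⟨v, hv⟩

/-- An r.i. space other than `L^∞` contains an unbounded function. -/
theorem exists_forall_volume_lt_abs_ne_zero (hX : X.IsBanachFunctionSpace) {e : X}
    (he : Represents e 1) (hne : X.carrier.toAddSubgroup ≠ Lp ℝ ∞ (volume : Measure I)) :
    ∃ w : X, ∀ c : ℝ, volume {x : I | c < |toFun w x|} ≠ 0 := by
  by_contra! h
  refine hne (le_antisymm (fun f hf => ?_) fun f hf => ?_)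
  · obtain ⟨c, hc⟩ := h ⟨f, hf⟩
    have hc : ∀ᵐ x : I, ‖f x‖ ≤ c := by
      have hfw : toFun (X := X) ⟨f, hf⟩ = f := rfl
      rw [hfw] at hc
      simpa [ae_iff] using hc
    exact Lp.mem_Lp_iff_memLp.2 (memLp_top_of_bound f.aestronglyMeasurable c hc)
  · have hf := Lp.mem_Lp_iff_memLp.1 hf
    obtain ⟨v, hv⟩ := exists_represents_of_bounded hX he (c := (eLpNorm f ∞ volume).toReal) hf.1 (by
      filter_upwards [ae_le_eLpNormEssSup (f := f)] with x hx
      rw [← Real.norm_eq_abs, ← toReal_enorm, eLpNorm_exponent_top]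
      exact ENNReal.toReal_mono (by simpa using hf.2.ne) hx)
    have hvf : toFun v = f := AEEqFun.ext hv
    rw [← hvf]
    exact v.2

/-- The fundamental function of an r.i. space other than `L^∞` tends to zero at zero: if `w ∈ X` is
unbounded, then the indicator of every set which is no larger than `{|w| > n}` has norm at most
`‖w‖ / n`. -/
theorem exists_norm_indicator_le (hX : X.IsRearrangementInvariant) {e : X}
    (he : Represents e 1) (hne : X.carrier.toAddSubgroup ≠ Lp ℝ ∞ (volume : Measure I))
    {η : ℝ} (hη : 0 < η) : ∃ δ : ℝ, 0 < δ ∧ ∀ (B : Set I) (v : X),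
      Represents v (B.indicator 1) → NullMeasurableSet B → volume.real B ≤ δ → ‖v‖ ≤ η := by
  obtain ⟨w, hw⟩ := exists_forall_volume_lt_abs_ne_zero hX.toIsBanachFunctionSpace he hne
  have hc : 0 < (‖w‖ + 1) / η := by positivity
  refine ⟨_, ENNReal.toReal_pos (hw ((‖w‖ + 1) / η)) (measure_ne_top _ _), fun B v hv hB hBle => ?_⟩
  obtain ⟨u, hu, hule⟩ := exists_represents_indicator_lt_abs hX.toIsBanachFunctionSpace w hc
  obtain ⟨v', hv', hle⟩ := hu.exists_indicator hX hB
    ((ENNReal.toReal_le_toReal (measure_ne_top _ _) (measure_ne_top _ _)).1 hBle)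
  rw [hv.unique hv']
  refine hle.trans (hule.trans ?_)
  rw [inv_div, div_mul_eq_mul_div, div_le_iff₀ (by positivity)]
  nlinarith [norm_nonneg w]

end NormedFunctionSpace

/-! ### Pointwise estimates for the Cesàro operator -/

theorem cesaro_indicator_one {A : Set I} (hA : NullMeasurableSet A) (x : I) :
    cesaro (A.indicator 1) x = volume.real (A ∩ Iic x) / x := by
  rw [cesaro, integral_indicator₀ (hA.mono_ac Measure.restrict_le_self.absolutelyContinuous)]
  simp only [Pi.one_apply, integral_const, smul_eq_mul, mul_one, measureReal_def,
    Measure.restrict_apply_univ, Measure.restrict_apply' measurableSet_Iic]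
  ring

theorem cesaro_indicator_nonneg {A : Set I} (hA : NullMeasurableSet A) (x : I) :
    0 ≤ cesaro (A.indicator 1) x := by
  rw [cesaro_indicator_one hA]
  exact div_nonneg measureReal_nonneg x.2.1

theorem cesaro_indicator_le_one {A : Set I} (hA : NullMeasurableSet A) (x : I) :
    cesaro (A.indicator 1) x ≤ 1 := by
  rw [cesaro_indicator_one hA]
  refine div_le_one_of_le₀ ((measureReal_mono inter_subset_right).trans_eq ?_) x.2.1
  rw [measureReal_def, unitInterval.volume_Iic, ENNReal.toReal_ofReal x.2.1]

theorem aestronglyMeasurable_cesaro_indicator {A : Set I} (hA : NullMeasurableSet A) :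
    AEStronglyMeasurable (cesaro (A.indicator 1)) volume := by
  have : cesaro (A.indicator 1) = fun x : I => volume.real (A ∩ Iic x) / (x : ℝ) :=
    funext (cesaro_indicator_one hA)
  rw [this]
  have hmono : Monotone fun x : I => volume.real (A ∩ Iic x) := fun x y hxy =>
    measureReal_mono (inter_subset_inter_right _ (Iic_subset_Iic.2 hxy))
  exact (hmono.measurable.div measurable_subtype_coe).aestronglyMeasurable

theorem cesaro_indicator_union {A B : Set I} (hA : NullMeasurableSet A)
    (hB : NullMeasurableSet B) (h : Disjoint A B) :
    cesaro ((A ∪ B).indicator 1) = cesaro (A.indicator 1) + cesaro (B.indicator 1) := by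
  ext x
  rw [Pi.add_apply, cesaro_indicator_one hA, cesaro_indicator_one hB,
    cesaro_indicator_one (hA.union hB), union_inter_distrib_right, ← add_div]
  congr 1
  rw [measureReal_def, measure_union₀ (hB.inter measurableSet_Iic.nullMeasurableSet)
    (h.mono inter_subset_left inter_subset_left).aedisjoint,
    ENNReal.toReal_add (measure_ne_top _ _) (measure_ne_top _ _)]
  rfl

theorem cesaroKernel_of_lt {y x : I} (h : x < y) : cesaroKernel y x = 0 := by
  simp [cesaroKernel, h]

theorem cesaroKernel_of_le {y x : I} (h : y ≤ x) : cesaroKernel y x = 1 / (x : ℝ) := by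
  simp [cesaroKernel, h, unitInterval.le_one']

theorem abs_cesaroKernel_le {y : I} (hy : 0 < y) (x : I) : |cesaroKernel y x| ≤ 1 / (y : ℝ) := by
  have hy' : (0 : ℝ) < y := hy
  rcases lt_or_ge x y with h | h
  · rw [cesaroKernel_of_lt h, abs_zero]
    positivity
  · rw [cesaroKernel_of_le h, abs_of_nonneg (one_div_nonneg.2 x.2.1)]
    exact one_div_le_one_div_of_le hy' h

theorem measurable_cesaroKernel (y : I) : Measurable (cesaroKernel y) :=
  (measurable_const.div measurable_subtype_coe).mul (measurable_one.indicator measurableSet_Icc)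

theorem cesaroKernel_mem_Icc {ε : ℝ} (hε : 0 < ε) {y : I} (hy : ε ≤ y) (x : I) :
    cesaroKernel y x ∈ Icc 0 ε⁻¹ := by
  have hy0 : 0 < y := by rw [← Subtype.coe_lt_coe]; exact hε.trans_le hy
  refine ⟨?_, (le_abs_self _).trans ((abs_cesaroKernel_le hy0 x).trans ?_)⟩
  · exact mul_nonneg (one_div_nonneg.2 x.2.1) (indicator_nonneg (fun _ _ => zero_le_one) _)
  · rw [one_div]
    exact inv_anti₀ hε hy

/-- Both functions vanish below `w` and `y`, and agree above them. -/
theorem abs_cesaroKernel_sub_le {ε δ : ℝ} (hε : 0 < ε) {y w : I} (hy : ε ≤ y) (hw : ε ≤ w)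
    (hyw : y ∈ Metric.closedBall w δ) (x : I) :
    |cesaroKernel y x - cesaroKernel w x| ≤ ε⁻¹ * (Metric.closedBall w δ).indicator 1 x := by
  rw [Metric.mem_closedBall, Subtype.dist_eq, Real.dist_eq, abs_le] at hyw
  by_cases hx : x ∈ Metric.closedBall w δ
  · rw [indicator_of_mem hx, Pi.one_apply, mul_one]
    have h1 := cesaroKernel_mem_Icc hε hy x
    have h2 := cesaroKernel_mem_Icc hε hw x
    exact abs_sub_le_of_nonneg_of_le h1.1 h1.2 h2.1 h2.2
  · rw [indicator_of_notMem hx, mul_zero]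
    rw [Metric.mem_closedBall, Subtype.dist_eq, Real.dist_eq, abs_le, not_and_or, not_le,
      not_le] at hx
    rcases hx with hx | hx
    · have h1 : x < y := by rw [← Subtype.coe_lt_coe]; linarith
      have h2 : x < w := by rw [← Subtype.coe_lt_coe]; linarith
      simp [cesaroKernel_of_lt h1, cesaroKernel_of_lt h2]
    · have h1 : y ≤ x := by rw [← Subtype.coe_le_coe]; linarith
      have h2 : w ≤ x := by rw [← Subtype.coe_le_coe]; linarith
      simp [cesaroKernel_of_le h1, cesaroKernel_of_le h2]

theorem volume_real_closedBall_le (w : I) {δ : ℝ} (hδ : 0 ≤ δ) :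
    volume.real (Metric.closedBall w δ) ≤ 2 * δ := by
  rw [measureReal_def, unitInterval.volume_apply]
  refine ENNReal.toReal_le_of_le_ofReal (by positivity) ?_
  rw [← Real.volume_closedBall (w : ℝ)]
  refine measure_mono ?_
  rintro _ ⟨x, hx, rfl⟩
  exact hx

theorem cesaro_indicator_le {ε : ℝ} (hε : 0 < ε) {A : Set I} (hA : NullMeasurableSet A)
    (hAε : ∀ x ∈ A, ε ≤ x) (x : I) : cesaro (A.indicator 1) x ≤ volume.real A / ε := by
  rw [cesaro_indicator_one hA]
  rcases lt_or_ge (x : ℝ) ε with hx | hx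
  · have : A ∩ Iic x = ∅ := eq_empty_of_forall_notMem fun y hy =>
      (hx.trans_le (hAε y hy.1)).not_ge hy.2
    rw [this, measureReal_empty, zero_div]
    positivity
  · exact div_le_div₀ measureReal_nonneg (measureReal_mono inter_subset_left) hε hx

/-- Both functions vanish below `A`, and agree above `A`. -/
theorem abs_cesaro_indicator_sub_le {ε δ : ℝ} (hε : 0 < ε) {A : Set I}
    (hA : NullMeasurableSet A) {w : I} (hAε : ∀ x ∈ A, ε ≤ x)
    (hAw : A ⊆ Metric.closedBall w δ) (hwA : w ∈ A) (x : I) :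
    |cesaro (A.indicator 1) x - volume.real A * cesaroKernel w x| ≤
      volume.real A / ε * (Metric.closedBall w δ).indicator 1 x := by
  have hδ : 0 ≤ δ := dist_nonneg.trans (hAw hwA)
  have hAw' : ∀ y ∈ A, -δ ≤ (y : ℝ) - w ∧ (y : ℝ) - w ≤ δ := fun y hy => abs_le.1 (hAw hy)
  by_cases hx : x ∈ Metric.closedBall w δ
  · rw [indicator_of_mem hx, Pi.one_apply, mul_one]
    have h2 := cesaroKernel_mem_Icc hε (hAε w hwA) x
    refine abs_sub_le_of_nonneg_of_le (cesaro_indicator_nonneg hA x)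
      (cesaro_indicator_le hε hA hAε x) (mul_nonneg measureReal_nonneg h2.1) ?_
    exact mul_le_mul_of_nonneg_left h2.2 measureReal_nonneg
  · rw [indicator_of_notMem hx, mul_zero, cesaro_indicator_one hA]
    rw [Metric.mem_closedBall, Subtype.dist_eq, Real.dist_eq, abs_le, not_and_or, not_le,
      not_le] at hx
    rcases hx with hx | hx
    · have h1 : A ∩ Iic x = ∅ := eq_empty_of_forall_notMem fun y hy => by
        have := (hAw' y hy.1).1
        have : (y : ℝ) ≤ x := hy.2
        linarith
      have h2 : x < w := by rw [← Subtype.coe_lt_coe]; linarith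
      simp [cesaroKernel_of_lt h2, h1]
    · have h1 : A ∩ Iic x = A := inter_eq_left.2 fun y hy => by
        have := (hAw' y hy).2
        rw [mem_Iic, ← Subtype.coe_le_coe]
        linarith
      have h2 : w ≤ x := by rw [← Subtype.coe_le_coe]; linarith
      rw [cesaroKernel_of_le h2, h1]
      simp [div_eq_mul_inv]

/-! ### The Cesàro vector measure and its kernel in `X` -/

namespace NormedFunctionSpace

open Filter Topology

variable {X : NormedFunctionSpace}

/-- The function `C(χ_A)` is at most `1` on `[0,r]` and at most `λ(A) / r` on `[r,1]`. -/
theorem norm_le_of_represents_cesaro (hX : X.IsBanachFunctionSpace) {A : Set I}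
    (hA : NullMeasurableSet A) {r : I} (hr : 0 < r) {e v w : X} (he : Represents e 1)
    (hv : Represents v (cesaro (A.indicator 1))) (hw : Represents w ((Iic r).indicator 1)) :
    ‖v‖ ≤ ‖w‖ + volume.real A / r * ‖e‖ := by
  have hr' : (0 : ℝ) < r := hr
  have hc : 0 ≤ volume.real A / r := by positivity
  have key : ‖v‖ ≤ 1 * ‖w + (volume.real A / (r : ℝ)) • e‖ := by
    refine hv.norm_le hX (hw.add (he.smul (volume.real A / (r : ℝ)))) zero_le_one fun x => ?_
    rw [one_mul, abs_of_nonneg (cesaro_indicator_nonneg hA x)]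
    refine le_trans ?_ (le_abs_self _)
    rcases le_or_gt x r with hx | hx
    · refine (cesaro_indicator_le_one hA x).trans ?_
      simpa [hx] using hc
    · rw [cesaro_indicator_one hA]
      have : volume.real (A ∩ Iic x) / (x : ℝ) ≤ volume.real A / r :=
        div_le_div₀ measureReal_nonneg (measureReal_mono inter_subset_left) hr' hx.le
      simpa [hx] using this
  rw [one_mul] at key
  refine key.trans ((norm_add_le _ _).trans_eq ?_)
  rw [norm_smul, Real.norm_of_nonneg hc]

theorem exists_norm_le_of_represents_cesaro (hX : X.IsRearrangementInvariant) {e : X}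
    (he : Represents e 1) (hne : X.carrier.toAddSubgroup ≠ Lp ℝ ∞ (volume : Measure I))
    {η : ℝ} (hη : 0 < η) : ∃ δ : ℝ, 0 < δ ∧ ∀ (A : Set I) (v : X), NullMeasurableSet A →
      Represents v (cesaro (A.indicator 1)) → volume.real A ≤ δ → ‖v‖ ≤ η := by
  obtain ⟨δ₀, hδ₀, H⟩ := exists_norm_indicator_le hX he hne (half_pos hη)
  have hr0 : 0 < min 1 δ₀ := lt_min one_pos hδ₀
  let r : I := ⟨min 1 δ₀, hr0.le, min_le_left _ _⟩
  obtain ⟨w, hw⟩ := exists_represents_of_bounded hX.toIsBanachFunctionSpace he (c := 1)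
    (g := (Iic r).indicator 1) (aestronglyMeasurable_one.indicator measurableSet_Iic)
    (.of_forall fun x => by by_cases hx : x ≤ r <;> simp [hx])
  have hwη : ‖w‖ ≤ η / 2 := by
    refine H _ w hw measurableSet_Iic.nullMeasurableSet ?_
    rw [measureReal_def, unitInterval.volume_Iic, ENNReal.toReal_ofReal r.2.1]
    exact min_le_right _ _
  refine ⟨min 1 δ₀ * (η / 2) / (‖e‖ + 1), by positivity, fun A v hA hv hle => ?_⟩
  have h1 := norm_le_of_represents_cesaro hX.toIsBanachFunctionSpace hA (r := r) hr0 he hv hw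
  have h2 : volume.real A / (r : ℝ) * ‖e‖ ≤ η / 2 := by
    rw [le_div_iff₀ (by positivity)] at hle
    rw [div_mul_eq_mul_div, div_le_iff₀ hr0]
    have : volume.real A * ‖e‖ ≤ volume.real A * (‖e‖ + 1) := by gcongr; simp
    change _ ≤ η / 2 * min 1 δ₀
    linarith
  linarith

/-- σ-additivity follows from finite additivity, since `λ(A) → 0` forces `C(χ_A) → 0` in `X`. -/
theorem exists_vectorMeasure_represents_cesaro (hX : X.IsRearrangementInvariant) {e : X}
    (he : Represents e 1) (hne : X.carrier.toAddSubgroup ≠ Lp ℝ ∞ (volume : Measure I)) :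
    ∃ m : VectorMeasure LebesgueInterval X, ∀ A : Set I, NullMeasurableSet A →
      Represents (m A) (cesaro (A.indicator 1)) := by
  classical
  have hex : ∀ A : Set I, ∃ v : X, NullMeasurableSet A →
      Represents v (cesaro (A.indicator 1)) := fun A => by
    by_cases hA : NullMeasurableSet A
    · obtain ⟨v, hv⟩ := exists_represents_of_bounded hX.toIsBanachFunctionSpace he
        (aestronglyMeasurable_cesaro_indicator hA) (c := 1) (.of_forall fun x => by
          rw [abs_of_nonneg (cesaro_indicator_nonneg hA x)]
          exact cesaro_indicator_le_one hA x)
      exact ⟨v, fun _ => hv⟩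
    · exact ⟨0, fun h => absurd h hA⟩
  choose v hv using hex
  have hempty : v ∅ = 0 := by
    refine (hv ∅ nullMeasurableSet_empty).unique (Represents.zero.trans (.of_eq ?_))
    ext x
    rw [cesaro_indicator_one nullMeasurableSet_empty]
    simp
  have hunion : ∀ A B : Set I, NullMeasurableSet A → NullMeasurableSet B → Disjoint A B →
      v (A ∪ B) = v A + v B := fun A B hA hB hAB => by
    refine (hv _ (hA.union hB)).unique ?_
    rw [cesaro_indicator_union hA hB hAB]
    exact (hv A hA).add (hv B hB)
  have hsum : ∀ f : ℕ → Set I, (∀ i, NullMeasurableSet (f i)) →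
      Pairwise (Function.onFun Disjoint f) → ∀ s : Finset ℕ,
      v (⋃ i ∈ s, f i) = ∑ i ∈ s, v (f i) := fun f hf hd s => by
    induction s using Finset.induction_on with
    | empty => simpa using hempty
    | insert i s hi ih =>
      rw [Finset.set_biUnion_insert, Finset.sum_insert hi, hunion _ _ (hf i)
        (s.nullMeasurableSet_biUnion fun j _ => hf j), ih]
      exact disjoint_iUnion₂_right.2 fun j hj => hd (by rintro rfl; exact hi hj)
  have hhasSum : ∀ f : ℕ → Set I, (∀ i, NullMeasurableSet (f i)) →
      Pairwise (Function.onFun Disjoint f) → HasSum (fun i => v (f i)) (v (⋃ i, f i)) := by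
    intro f hf hd
    refine Metric.tendsto_nhds.2 fun η hη => ?_
    obtain ⟨δ, hδ, H⟩ := exists_norm_le_of_represents_cesaro hX he hne (half_pos hη)
    have hfin : ∑' i, (volume : Measure I) (f i) ≠ ∞ := by
      rw [← measure_iUnion₀ (fun i j hij => (hd hij).aedisjoint) hf]
      exact measure_ne_top _ _
    have htail := ENNReal.tendsto_tsum_compl_atTop_zero hfin
    filter_upwards [htail.eventually (ge_mem_nhds (ENNReal.ofReal_pos.2 hδ))] with s hs
    have hfs : NullMeasurableSet (⋃ i ∈ s, f i) := s.nullMeasurableSet_biUnion fun j _ => hf j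
    have hft : NullMeasurableSet (⋃ i : {i // i ∉ s}, f i) :=
      NullMeasurableSet.iUnion fun i => hf i
    have hdisj : Disjoint (⋃ i ∈ s, f i) (⋃ i : {i // i ∉ s}, f i) :=
      disjoint_iUnion₂_left.2 fun i hi => disjoint_iUnion_right.2 fun j =>
        hd (by rintro rfl; exact j.2 hi)
    have hU : ⋃ i, f i = (⋃ i ∈ s, f i) ∪ ⋃ i : {i // i ∉ s}, f i := by
      ext x
      simp only [mem_iUnion, mem_union, Subtype.exists, exists_prop]
      constructor
      · rintro ⟨i, hi⟩
        by_cases his : i ∈ s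
        · exact .inl ⟨i, his, hi⟩
        · exact .inr ⟨i, his, hi⟩
      · rintro (⟨i, _, hi⟩ | ⟨i, _, hi⟩) <;> exact ⟨i, hi⟩
    rw [hU, hunion _ _ hfs hft hdisj, hsum f hf hd s, dist_self_add_right]
    refine (H _ _ hft (hv _ hft) (ENNReal.toReal_le_of_le_ofReal hδ.le ?_)).trans_lt
      (half_lt_self hη)
    exact (measure_iUnion_le _).trans hs
  refine ⟨⟨fun A => if MeasurableSet A then v A else 0, ?_, fun A hA => if_neg hA,
    fun f hf hd => ?_⟩, fun A hA => ?_⟩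
  · rw [if_pos MeasurableSet.empty]
    exact hempty
  · rw [if_pos (MeasurableSet.iUnion hf)]
    simp only [hf, if_true]
    exact hhasSum f hf hd
  · change Represents (if MeasurableSet (α := LebesgueInterval) A then v A else 0) _
    rw [if_pos (show MeasurableSet (α := LebesgueInterval) A from hA)]
    exact hv A hA

theorem norm_sub_smul_le_of_represents (hX : X.IsBanachFunctionSpace) {ε δ : ℝ} (hε : 0 < ε)
    {A : Set I} (hA : NullMeasurableSet A) (hAε : ∀ x ∈ A, ε ≤ x) {w : I} (hwA : w ∈ A)
    (hAw : A ⊆ Metric.closedBall w δ) {v f u : X}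
    (hv : Represents v (cesaro (A.indicator 1))) (hf : Represents f (cesaroKernel w))
    (hu : Represents u ((Metric.closedBall w δ).indicator 1)) :
    ‖v - volume.real A • f‖ ≤ volume.real A / ε * ‖u‖ := by
  refine (hv.sub (hf.smul _)).norm_le hX hu (by positivity) fun x => ?_
  exact (abs_cesaro_indicator_sub_le hε hA hAε hAw hwA x).trans
    (mul_le_mul_of_nonneg_left (le_abs_self _) (by positivity))

theorem norm_sub_le_of_represents_cesaroKernel (hX : X.IsBanachFunctionSpace) {ε δ : ℝ}
    (hε : 0 < ε) {y w : I} (hy : ε ≤ y) (hw : ε ≤ w) (hyw : y ∈ Metric.closedBall w δ)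
    {f g u : X} (hf : Represents f (cesaroKernel y)) (hg : Represents g (cesaroKernel w))
    (hu : Represents u ((Metric.closedBall w δ).indicator 1)) : ‖f - g‖ ≤ ε⁻¹ * ‖u‖ := by
  refine (hf.sub hg).norm_le hX hu (by positivity) fun x => ?_
  exact (abs_cesaroKernel_sub_le hε hy hw hyw x).trans
    (mul_le_mul_of_nonneg_left (le_abs_self _) (by positivity))

theorem exists_represents_closedBall_norm_le (hX : X.IsRearrangementInvariant) {e : X}
    (he : Represents e 1) (hne : X.carrier.toAddSubgroup ≠ Lp ℝ ∞ (volume : Measure I))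
    {η : ℝ} (hη : 0 < η) : ∃ δ : ℝ, 0 < δ ∧ ∀ w : I, ∃ u : X,
      Represents u ((Metric.closedBall w δ).indicator 1) ∧ ‖u‖ ≤ η := by
  obtain ⟨δ, hδ, H⟩ := exists_norm_indicator_le hX he hne hη
  refine ⟨δ / 2, half_pos hδ, fun w => ?_⟩
  have hm : MeasurableSet (Metric.closedBall w (δ / 2)) := Metric.isClosed_closedBall.measurableSet
  obtain ⟨u, hu⟩ := exists_represents_of_bounded hX.toIsBanachFunctionSpace he (c := 1)
    (g := (Metric.closedBall w (δ / 2)).indicator 1) (aestronglyMeasurable_one.indicator hm)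
    (.of_forall fun x => by
      by_cases hx : x ∈ Metric.closedBall w (δ / 2)
      · rw [indicator_of_mem hx]; simp
      · rw [indicator_of_notMem hx]; simp)
  refine ⟨u, hu, H _ u hu hm.nullMeasurableSet ?_⟩
  exact (volume_real_closedBall_le w (half_pos hδ).le).trans_eq (by ring)

theorem continuousOn_of_represents_cesaroKernel  {F : I → X}
    (hF : ∀ y, 0 < y → Represents (F y) (cesaroKernel y)) (hX : X.IsRearrangementInvariant) {e : X}
    (he : Represents e 1) (hne : X.carrier.toAddSubgroup ≠ Lp ℝ ∞ (volume : Measure I))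
    {ε : ℝ} (hε : 0 < ε) : ContinuousOn F {y : I | ε ≤ y} := by
  intro w hw
  refine Metric.tendsto_nhds.2 fun η hη => ?_
  obtain ⟨δ, hδ, H⟩ := exists_represents_closedBall_norm_le hX he hne
    (show 0 < η / 2 * ε by positivity)
  obtain ⟨u, hu, hule⟩ := H w
  filter_upwards [self_mem_nhdsWithin,
    mem_nhdsWithin_of_mem_nhds (Metric.closedBall_mem_nhds w hδ)] with y hy hyw
  rw [dist_eq_norm]
  refine (norm_sub_le_of_represents_cesaroKernel hX.toIsBanachFunctionSpace hε hy hw hyw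
    (hF y (hε.trans_le hy)) (hF w (hε.trans_le hw)) hu).trans_lt ?_
  calc ε⁻¹ * ‖u‖ ≤ ε⁻¹ * (η / 2 * ε) := by gcongr
    _ = η / 2 := by field_simp
    _ < η := half_lt_self hη

theorem norm_le_of_represents_cesaroKernel  {F : I → X}
    (hF : ∀ y, 0 < y → Represents (F y) (cesaroKernel y)) (hX : X.IsBanachFunctionSpace) {e : X}
    (he : Represents e 1) {ε : ℝ} (hε : 0 < ε) {y : I} (hy : ε ≤ y) : ‖F y‖ ≤ ε⁻¹ * ‖e‖ := by
  refine (hF y (hε.trans_le hy)).norm_le hX he (by positivity) fun x => ?_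
  obtain ⟨h0, h1⟩ := cesaroKernel_mem_Icc hε hy x
  simpa [abs_of_nonneg h0] using h1

end NormedFunctionSpace

/-! ### The kernel as a density of the Cesàro vector measure -/

instance : IsProbabilityMeasure lebesgueInterval :=
  ⟨measure_univ (μ := (volume : Measure I))⟩

theorem measurable_id_lebesgueInterval : Measurable (α := LebesgueInterval) (β := I) id :=
  (measurable_id (α := I)).nullMeasurable.measurable'

/-- The map `y ↦ ⌊1 / y⌋`, whose fibers divide `[0,1]` into the intervals `(1/(n+1), 1/n]` for
`n > 0` and the null set `{0}`, the fiber over `0`, because `1 / 0 = 0`. -/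
noncomputable def reciprocalFloor (y : I) : ℕ := ⌊1 / (y : ℝ)⌋₊

theorem measurable_reciprocalFloor : Measurable (α := LebesgueInterval) reciprocalFloor :=
  (Nat.measurable_floor.comp (measurable_const.div measurable_subtype_coe :
    Measurable fun y : I => 1 / (y : ℝ))).comp measurable_id_lebesgueInterval

namespace NormedFunctionSpace

open Filter Topology

variable {X : NormedFunctionSpace}

/-- On `(0,1]` the function `F` is the limit of the continuous functions `y ↦ F (max y (1/n))`. -/
theorem stronglyMeasurable_of_represents_cesaroKernel {F : I → X}
    (hF : ∀ y, 0 < y → Represents (F y) (cesaroKernel y)) (hX : X.IsRearrangementInvariant) {e : X}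
    (he : Represents e 1) (hne : X.carrier.toAddSubgroup ≠ Lp ℝ ∞ (volume : Measure I)) :
    StronglyMeasurable F := by
  let r : ℕ → I := fun n => ⟨1 / ((n : ℝ) + 1), by positivity,
    div_le_one_of_le₀ (by simp) (by positivity)⟩
  have hr : ∀ n, (0 : ℝ) < r n := fun n => by positivity
  have hcont : ∀ n, Continuous fun y : I => F (max y (r n)) := fun n =>
    (continuousOn_of_represents_cesaroKernel hF hX he hne (hr n)).comp_continuous
      (continuous_id.max continuous_const)
      fun y => show ((r n : I) : ℝ) ≤ (max y (r n) : I) from le_max_right y (r n)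
  have hmeas : ∀ n, StronglyMeasurable fun y : I => if y = 0 then F 0 else F (max y (r n)) :=
    fun n => stronglyMeasurable_const.ite (measurableSet_singleton 0) (hcont n).stronglyMeasurable
  refine stronglyMeasurable_of_tendsto atTop hmeas (tendsto_pi_nhds.2 fun y => ?_)
  rcases eq_or_ne y 0 with rfl | hy
  · simp
  · have hy0 : (0 : ℝ) < y := unitInterval.pos_iff_ne_zero.2 hy
    refine tendsto_const_nhds.congr' ?_
    filter_upwards [tendsto_one_div_add_atTop_nhds_zero_nat.eventually_le_const hy0] with n hn
    rw [if_neg hy, max_eq_left (show r n ≤ y from hn)]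

/-- On a set `A ∋ w` of diameter at most `δ`, both `m A` and the integral of `F` over `A` are within
`λ(A) ‖χ_{B(w,δ)}‖ / ε` of `λ(A) F_w`. -/
theorem hasBochnerDensityOn_of_represents_cesaro {F : I → X}
    (hF : ∀ y, 0 < y → Represents (F y) (cesaroKernel y)) {m : VectorMeasure LebesgueInterval X}
    (hm : ∀ A : Set I, NullMeasurableSet A → Represents (m A) (cesaro (A.indicator 1)))
    (hX : X.IsRearrangementInvariant) {e : X}
    (he : Represents e 1) (hne : X.carrier.toAddSubgroup ≠ Lp ℝ ∞ (volume : Measure I))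
    {ε : ℝ} (hε : 0 < ε) :
    VectorMeasure.HasBochnerDensityOn m F lebesgueInterval {y : I | ε ≤ y} := by
  have : CompleteSpace X := hX.complete
  have hFm : StronglyMeasurable (α := LebesgueInterval) F :=
    (stronglyMeasurable_of_represents_cesaroKernel hF hX he hne).comp_measurable
      measurable_id_lebesgueInterval
  have hSm : MeasurableSet {y : I | ε ≤ y} := measurableSet_le measurable_const (by fun_prop)
  have hS : MeasurableSet (α := LebesgueInterval) {y : I | ε ≤ y} := hSm.nullMeasurableSet
  have hint : IntegrableOn (α := LebesgueInterval) F {y : I | ε ≤ y} lebesgueInterval :=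
    Measure.integrableOn_of_bounded (M := ε⁻¹ * ‖e‖) (measure_ne_top _ _)
      hFm.aestronglyMeasurable (ae_restrict_of_forall_mem hS fun y hy =>
        norm_le_of_represents_cesaroKernel hF hX.toIsBanachFunctionSpace he hε hy)
  refine .of_forall_exists_approx hS hint fun c hc => ?_
  obtain ⟨δ, hδ, H⟩ := exists_represents_closedBall_norm_le hX he hne (mul_pos hε hc)
  obtain ⟨n, hn⟩ := exists_nat_one_div_lt hδ
  have hn0 : (0 : ℝ) < n + 1 := by positivity
  let k : I → ℕ := fun x => ⌊(x : ℝ) * (n + 1)⌋₊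
  have hk : Measurable k :=
    Nat.measurable_floor.comp (by fun_prop : Measurable fun x : I => (x : ℝ) * (n + 1))
  refine ⟨k, hk.comp measurable_id_lebesgueInterval, fun j (A : Set I) hA hAS hAj hAne => ?_⟩
  obtain ⟨w, hw⟩ : ∃ w : I, w ∈ A := hAne
  have hAε : ∀ x ∈ A, ε ≤ x := hAS
  have hAw : A ⊆ Metric.closedBall w δ := fun x hx => by
    have h1 : k x = j := hAj hx
    have h2 : k w = j := hAj hw
    rw [Nat.floor_eq_iff (mul_nonneg x.2.1 hn0.le)] at h1
    rw [Nat.floor_eq_iff (mul_nonneg w.2.1 hn0.le)] at h2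
    refine le_trans ?_ hn.le
    rw [Subtype.dist_eq, Real.dist_eq, le_div_iff₀ hn0, ← abs_of_pos hn0, ← abs_mul,
      sub_mul, abs_le]
    constructor <;> linarith
  obtain ⟨u, hu, hule⟩ := H w
  have hu' : ε⁻¹ * ‖u‖ ≤ c := by rwa [inv_mul_le_iff₀ hε]
  refine ⟨F w, ?_, fun x hx => ?_⟩
  · refine (norm_sub_smul_le_of_represents hX.toIsBanachFunctionSpace hε hA hAε hw hAw (hm A hA)
      (hF w (hε.trans_le (hAε w hw))) hu).trans ?_
    calc volume.real A / ε * ‖u‖ = ε⁻¹ * ‖u‖ * volume.real A := by ring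
      _ ≤ c * volume.real A := by gcongr
  · exact (norm_sub_le_of_represents_cesaroKernel hX.toIsBanachFunctionSpace hε (hAε x hx)
      (hAε w hw) (hAw hx) (hF x (hε.trans_le (hAε x hx))) (hF w (hε.trans_le (hAε w hw)))
      hu).trans hu'

theorem hasBochnerDensityOn_reciprocalFloor_preimage {F : I → X}
    (hF : ∀ y, 0 < y → Represents (F y) (cesaroKernel y)) {m : VectorMeasure LebesgueInterval X}
    (hm : ∀ A : Set I, NullMeasurableSet A → Represents (m A) (cesaro (A.indicator 1)))
    (hX : X.IsRearrangementInvariant) {e : X}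
    (he : Represents e 1) (hne : X.carrier.toAddSubgroup ≠ Lp ℝ ∞ (volume : Measure I)) (n : ℕ) :
    VectorMeasure.HasBochnerDensityOn (Ω := LebesgueInterval) m F lebesgueInterval
      (reciprocalFloor ⁻¹' {n}) := by
  rcases Nat.eq_zero_or_pos n with rfl | hn
  · have hsub : reciprocalFloor ⁻¹' {0} ⊆ {0} := fun y hy => by
      by_contra hy0
      have hy0 : (0 : ℝ) < y := unitInterval.pos_iff_ne_zero.2 hy0
      have : 1 / (y : ℝ) < 1 := Nat.floor_eq_zero.1 hy
      rw [div_lt_one hy0] at this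
      exact this.not_ge y.2.2
    have hnull : lebesgueInterval (reciprocalFloor ⁻¹' {0}) = 0 :=
      measure_mono_null hsub (measure_singleton (μ := (volume : Measure I)) 0)
    refine .of_measure_zero hnull fun (A : Set I) hA hAk => ?_
    have hA0 : volume A = 0 := measure_mono_null (μ := lebesgueInterval) hAk hnull
    refine (hm A hA).unique (Represents.zero.trans (.of_eq ?_))
    ext x
    rw [cesaro_indicator_one hA]
    have : volume.real (A ∩ Iic x) = 0 := by
      rw [measureReal_def, measure_mono_null inter_subset_left hA0, ENNReal.toReal_zero]
    rw [this, zero_div, Pi.zero_apply]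
  · have hn' : (0 : ℝ) < n + 1 := by positivity
    have h := hasBochnerDensityOn_of_represents_cesaro hF hm hX he hne
      (inv_pos.2 hn')
    have hsub : reciprocalFloor ⁻¹' {n} ⊆ {y : I | ((n : ℝ) + 1)⁻¹ ≤ y} := fun y hy => by
      have hy : ⌊1 / (y : ℝ)⌋₊ = n := hy
      rw [Nat.floor_eq_iff (one_div_nonneg.2 y.2.1), one_div] at hy
      have hy0 : (0 : ℝ) < y := inv_pos.1 ((Nat.cast_pos.2 hn).trans_le hy.1)
      exact (inv_le_comm₀ hn' hy0).2 hy.2.le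
    exact h.mono hsub

/-- The averages of `F` over subsets of `[r,1]` lie in the closed absolutely convex hull of the
compact set `F([r,1])`, and they approximate the range of `m` uniformly as `r → 0`. -/
theorem totallyBounded_range_of_represents_cesaro {F : I → X}
    (hF : ∀ y, 0 < y → Represents (F y) (cesaroKernel y)) {m : VectorMeasure LebesgueInterval X}
    (hm : ∀ A : Set I, NullMeasurableSet A → Represents (m A) (cesaro (A.indicator 1)))
    (hX : X.IsRearrangementInvariant) {e : X}
    (he : Represents e 1) (hne : X.carrier.toAddSubgroup ≠ Lp ℝ ∞ (volume : Measure I)) :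
    TotallyBounded {f : X | ∃ A : Set LebesgueInterval, MeasurableSet A ∧ m A = f} := by
  have : CompleteSpace X := hX.complete
  refine Metric.totallyBounded_iff.2 fun η hη => ?_
  obtain ⟨δ, hδ, H⟩ := exists_norm_le_of_represents_cesaro hX he hne (half_pos (half_pos hη))
  have hr0 : 0 < min 1 δ := lt_min one_pos hδ
  let r : I := ⟨min 1 δ, hr0.le, min_le_left _ _⟩
  have hdens := hasBochnerDensityOn_of_represents_cesaro hF hm hX he hne (ε := r) hr0
  have hScomp : IsCompact {y : I | (r : ℝ) ≤ y} := (isClosed_Ici (a := r)).isCompact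
  have hSm : MeasurableSet {y : I | (r : ℝ) ≤ y} := measurableSet_Ici (a := r)
  have hS : MeasurableSet (α := LebesgueInterval) {y : I | (r : ℝ) ≤ y} := hSm.nullMeasurableSet
  set S : Set LebesgueInterval := {y : I | (r : ℝ) ≤ y} with hSdef
  have hFS : IsCompact (F '' S) := hScomp.image_of_continuousOn
    (continuousOn_of_represents_cesaroKernel hF hX he hne hr0)
  have hKcomp : IsCompact (closedAbsConvexHull ℝ (F '' S)) :=
    isCompact_closedAbsConvexHull_of_totallyBounded hFS.totallyBounded
  obtain ⟨t, ht, htK⟩ := Metric.totallyBounded_iff.1 hKcomp.totallyBounded (η / 2) (half_pos hη)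
  refine ⟨t, ht, ?_⟩
  rintro _ ⟨A, hA, rfl⟩
  have hsplit : m A = m (A ∩ S) + m (A \ S) := by
    rw [← VectorMeasure.of_union (disjoint_sdiff_inter.symm) (hA.inter hS) (hA.diff hS),
      inter_union_sdiff]
  have hmem : m (A ∩ S) ∈ closedAbsConvexHull ℝ (F '' S) := by
    have h0 : (0 : X) ∈ closedAbsConvexHull ℝ (F '' S) :=
      absConvex_convexClosedHull.1.zero_mem
        ⟨F 1, subset_closedAbsConvexHull (mem_image_of_mem F r.2.2)⟩
    exact hdens.apply_mem (hA.inter hS) inter_subset_right absConvex_convexClosedHull.2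
      isClosed_closedAbsConvexHull h0 fun x hx => subset_closedAbsConvexHull
        (mem_image_of_mem F hx.2)
  have hrest : ‖m (A \ S)‖ ≤ η / 2 / 2 := by
    refine H _ _ (hA.diff hS) (hm _ (hA.diff hS)) ?_
    have : volume.real (α := I) (A \ S) ≤ volume.real (Iic r) :=
      measureReal_mono fun x hx => (not_le.1 (show ¬ r ≤ x from hx.2)).le
    refine this.trans ?_
    rw [measureReal_def, unitInterval.volume_Iic, ENNReal.toReal_ofReal r.2.1]
    exact min_le_right _ _
  obtain ⟨c, hc, hcm⟩ := mem_iUnion₂.1 (htK hmem)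
  refine mem_iUnion₂.2 ⟨c, hc, ?_⟩
  rw [Metric.mem_ball] at hcm ⊢
  calc dist (m A) c ≤ dist (m A) (m (A ∩ S)) + dist (m (A ∩ S)) c := dist_triangle _ _ _
    _ < η / 2 + η / 2 := by
      refine add_lt_add ?_ hcm
      rw [dist_eq_norm, hsplit, add_sub_cancel_left]
      exact hrest.trans_lt (half_lt_self (half_pos hη))
    _ = η := add_halves η

end NormedFunctionSpace

theorem theorem2p1 (X : NormedFunctionSpace) (hX : X.IsRearrangementInvariant)
    (hX_ne_zero : X.carrier ≠ ⊥)
    (hX_ne_Linfty : X.carrier.toAddSubgroup ≠ Lp ℝ ∞ (volume : Measure I)) :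
    ∃ (m : VectorMeasure LebesgueInterval X) (F : LebesgueInterval → X),
      -- the σ-additive vector measure `m` is `A ↦ C(χ_A)`
      (∀ A : Set LebesgueInterval, MeasurableSet A →
        ∀ᵐ x : I, NormedFunctionSpace.toFun (m A) x = cesaro (Set.indicator (α := I) A 1) x) ∧
      -- `F_y` is the class of `x ↦ (1/x) χ_{[y,1]}(x)`, for `0 < y ≤ 1`
      (∀ y : I, 0 < y → ∀ᵐ x : I, NormedFunctionSpace.toFun (F y) x = cesaroKernel y x) ∧
      -- `F` is a strongly measurable, Pettis integrable density of `m`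
      StronglyMeasurable F ∧
      PettisIntegrable lebesgueInterval F ∧
      (∀ A : Set LebesgueInterval, MeasurableSet A →
        IsPettisIntegralOn lebesgueInterval F A (m A)) ∧
      -- the variation of `m`
      SigmaFinite m.variation ∧
      (∀ A : Set LebesgueInterval, MeasurableSet A →
        m.variation A = ∫⁻ y in A, ‖F y‖ₑ ∂lebesgueInterval) ∧
      (m.variation univ < ∞ → Integrable F lebesgueInterval) ∧
      -- the range of `m`
      IsCompact (closure {f : X | ∃ A : Set LebesgueInterval, MeasurableSet A ∧ m A = f}) := by
  have : CompleteSpace X := hX.complete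
  obtain ⟨e, he⟩ := NormedFunctionSpace.exists_represents_one hX hX_ne_zero
  obtain ⟨m, hm⟩ := NormedFunctionSpace.exists_vectorMeasure_represents_cesaro hX he hX_ne_Linfty
  have hex : ∀ y : I, ∃ f : X, 0 < y →
      NormedFunctionSpace.Represents f (cesaroKernel y) := fun y => by
    by_cases hy : 0 < y
    · obtain ⟨f, hf⟩ := NormedFunctionSpace.exists_represents_of_bounded
        hX.toIsBanachFunctionSpace he (measurable_cesaroKernel y).aestronglyMeasurable
        (.of_forall (abs_cesaroKernel_le hy))
      exact ⟨f, fun _ => hf⟩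
    · exact ⟨0, fun h => absurd h hy⟩
  choose F hF using hex
  have hFm : StronglyMeasurable (α := LebesgueInterval) F :=
    (NormedFunctionSpace.stronglyMeasurable_of_represents_cesaroKernel hF hX he
      hX_ne_Linfty).comp_measurable measurable_id_lebesgueInterval
  have hdens := NormedFunctionSpace.hasBochnerDensityOn_reciprocalFloor_preimage hF hm hX he
    hX_ne_Linfty
  have hvar := VectorMeasure.HasBochnerDensityOn.variation_eq_withDensity
    (Ω := LebesgueInterval) (F := F) measurable_reciprocalFloor hdens
  have hPettis : ∀ A : Set LebesgueInterval, MeasurableSet A →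
      IsPettisIntegralOn lebesgueInterval F A (m A) := fun A hA =>
    VectorMeasure.HasBochnerDensityOn.isPettisIntegralOn (Ω := LebesgueInterval)
      measurable_reciprocalFloor hdens hFm.aestronglyMeasurable hA
  have hvarA : ∀ A : Set LebesgueInterval, MeasurableSet A →
      m.variation A = ∫⁻ y in A, ‖F y‖ₑ ∂lebesgueInterval := fun A hA => by
    rw [hvar, MeasureTheory.withDensity_apply _ hA]
  refine ⟨m, F, hm, hF, hFm, fun A hA => ⟨m A, hPettis A hA⟩, hPettis, ?_, hvarA, fun h => ?_, ?_⟩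
  · rw [hvar]
    exact SigmaFinite.withDensity_of_ne_top (.of_forall fun x => enorm_ne_top)
  · refine ⟨hFm.aestronglyMeasurable, ?_⟩
    rwa [hvarA _ .univ, setLIntegral_univ] at h
  · exact (NormedFunctionSpace.totallyBounded_range_of_represents_cesaro hF hm hX he
      hX_ne_Linfty).closure.isCompact_of_isClosed isClosed_closure
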